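/- For $0\le k<1$ let $K(k)=\int_0^{\pi/2}\frac{d\theta}{\sqrt{1-k^2\sin^2\theta}}$ and $E(k)=\int_0^{\pi/2}\sqrt{1-k^2\sin^2\theta}\,d\theta$ be the complete elliptic integrals of the first and second kind with modulus $k$, and for $0<x\le 16$ put $$V_4(x)=\frac{1}{15\pi^2}\left[\left(\frac{64}{\sqrt x}+56\sqrt x+\frac{x^{3/2}}{4}\right)E\!\left(\sqrt{1-\tfrac{x}{16}}\right)-2\sqrt x\,(16+x)\,K\!\left(\sqrt{1-\tfrac{x}{16}}\right)\right].$$ Then $V_4$ is integrable on $(0,16)$ and solves the Hausdorff moment problem $$\int_0^{16}x^n\,V_4(x)\,dx=\frac{6\,(2n)!\,(2n+2)!}{\prod_{r=0}^{3}(n+r)!},\qquad n=0,1,2,\dots.$$ Moreover $V_4(x)>0$ for $0<x<16$, and $V_4$ is the unique solution: every integrable function $W:(0,16)\to\mathbb R$ with these moments equals $V_4$ almost everywhere on $(0,16)$. -/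

import Mathlib

open MeasureTheory

noncomputable section

/-- Complete elliptic integral of the first kind, as a function of the modulus `k` (`|k| < 1`). -/
def ellipticK (k : ℝ) : ℝ :=
  ∫ θ in (0 : ℝ)..(Real.pi / 2), 1 / √(1 - k ^ 2 * Real.sin θ ^ 2)

/-- Complete elliptic integral of the second kind, as a function of the modulus `k` (`|k| ≤ 1`). -/
def ellipticE (k : ℝ) : ℝ :=
  ∫ θ in (0 : ℝ)..(Real.pi / 2), √(1 - k ^ 2 * Real.sin θ ^ 2)

/-- The sequence `D₄(n) = 6 (2n)! (2n+2)! / ∏_{r=0}^{3} (n+r)!`, as a real number. -/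
def D4 (n : ℕ) : ℝ :=
  6 * ((2 * n).factorial : ℝ) * ((2 * n + 2).factorial : ℝ) /
    ∏ r ∈ Finset.range 4, ((n + r).factorial : ℝ)

/-- `V` is a weight on `[0, 16]` whose `n`-th power moment exists and equals `D₄(n)`, for all `n`. -/
def SolvesMomentProblem (V : ℝ → ℝ) : Prop :=
  ∀ n : ℕ, IntervalIntegrable (fun x : ℝ => x ^ n * V x) volume 0 16 ∧
    ∫ x in (0 : ℝ)..16, x ^ n * V x = D4 n

/-- The closed form of the weight (meaningful for `0 < x ≤ 16`). -/
def V4 (x : ℝ) : ℝ :=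
  1 / (15 * Real.pi ^ 2) *
    ((64 / √x + 56 * √x + x ^ (3 / 2 : ℝ) / 4) * ellipticE (√(1 - x / 16))
      - 2 * √x * (16 + x) * ellipticK (√(1 - x / 16)))

end

/-! Put x = 16y² and m = 1 - y². Then `V4` becomes 16/(15π²y) times a polynomial combination of E
and K, and both are values of `ellipticPow`, at exponents 1/2 and -1/2.

Moments: the substitution v = √(1 - (1 - y²) sin² θ) gives the integrand the kernel v / (√(1 - v²)
√(v² - y²)) on y < v < 1. Integrating over y first (Tonelli), with y = v sin β and then v = sin α,
splits each moment of E or K into a product of two Wallis integrals. Five such products add up to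
`D4 n`.

Positivity: the combination of E and K vanishes at m = 0, and differentiating it repeatedly lowers
its complexity, each derivative being a positive multiple of another combination that vanishes at 0,
until K - E > 0 is reached.

Uniqueness: an integrable function with vanishing moments on a compact interval is orthogonal to all
continuous functions by Weierstrass approximation, hence null. -/

/-! ### Elliptic integrals in the parameter m and their derivatives. -/

/-- The integral `∫₀^{π/2} (1 - m sin² θ)^a dθ`, with parameter `m = k²`. -/
noncomputable def ellipticPow (a m : ℝ) : ℝ :=
  ∫ θ in (0 : ℝ)..(Real.pi / 2), (1 - m * Real.sin θ ^ 2) ^ a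

theorem one_sub_mul_sin_sq_pos {m : ℝ} (hm : m < 1) (θ : ℝ) : 0 < 1 - m * Real.sin θ ^ 2 := by
  have h1 := Real.sin_sq_le_one θ
  rcases le_total m 0 with h | h <;> nlinarith [sq_nonneg (Real.sin θ)]

theorem continuous_one_sub_mul_sin_sq_rpow (a : ℝ) {m : ℝ} (hm : m < 1) :
    Continuous fun θ : ℝ => (1 - m * Real.sin θ ^ 2) ^ a :=
  Continuous.rpow_const (by fun_prop) fun θ => Or.inl (one_sub_mul_sin_sq_pos hm θ).ne'

theorem ellipticE_sqrt {m : ℝ} (hm : 0 ≤ m) : ellipticE √m = ellipticPow (1 / 2) m := by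
  simp only [ellipticE, ellipticPow, Real.sq_sqrt hm, Real.sqrt_eq_rpow (1 - _)]

theorem ellipticK_sqrt {m : ℝ} (hm : 0 ≤ m) (hm1 : m < 1) :
    ellipticK √m = ellipticPow (-1 / 2) m := by
  simp only [ellipticK, ellipticPow, Real.sq_sqrt hm]
  congr 1; ext θ
  rw [Real.sqrt_eq_rpow, neg_div, Real.rpow_neg (one_sub_mul_sin_sq_pos hm1 θ).le, one_div]

theorem ellipticPow_zero (a : ℝ) : ellipticPow a 0 = Real.pi / 2 := by
  simp [ellipticPow]

/-- Differentiation under the integral sign. -/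
theorem hasDerivAt_ellipticPow (a : ℝ) {m : ℝ} (hm0 : -1 < m) (hm : m < 1) :
    HasDerivAt (ellipticPow a)
      (∫ θ in (0 : ℝ)..(Real.pi / 2),
        -(a * Real.sin θ ^ 2 * (1 - m * Real.sin θ ^ 2) ^ (a - 1))) m := by
  -- The compact range [-1, (1+m)/2] contains a neighbourhood of m and stays away from the
  -- singularity at 1, so compactness yields a constant dominating function.
  have hlt : ∀ x ∈ Set.Icc (-1 : ℝ) ((1 + m) / 2), x < 1 := fun x hx => by linarith [hx.2]
  have hcont : ContinuousOn (fun p : ℝ × ℝ =>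
      -(a * Real.sin p.2 ^ 2 * (1 - p.1 * Real.sin p.2 ^ 2) ^ (a - 1)))
      (Set.Icc (-1) ((1 + m) / 2) ×ˢ Set.Icc 0 (Real.pi / 2)) := by
    refine ContinuousOn.neg (ContinuousOn.mul (by fun_prop) (ContinuousOn.rpow_const (by fun_prop) ?_))
    rintro ⟨x, θ⟩ ⟨hx, -⟩
    exact Or.inl (one_sub_mul_sin_sq_pos (hlt x hx) θ).ne'
  obtain ⟨C, hC⟩ := (isCompact_Icc.prod isCompact_Icc).exists_bound_of_continuousOn hcont
  refine (intervalIntegral.hasDerivAt_integral_of_dominated_loc_of_deriv_le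
    (F := fun x θ => (1 - x * Real.sin θ ^ 2) ^ a)
    (F' := fun x θ => -(a * Real.sin θ ^ 2 * (1 - x * Real.sin θ ^ 2) ^ (a - 1)))
    (bound := fun _ => C) (s := Set.Ioo (-1) ((1 + m) / 2))
    (Ioo_mem_nhds hm0 (by linarith)) ?_ ?_ ?_ ?_ ?_ ?_).2
  · filter_upwards [Iio_mem_nhds hm] with x hx
    exact (continuous_one_sub_mul_sin_sq_rpow a hx).aestronglyMeasurable
  · exact (continuous_one_sub_mul_sin_sq_rpow a hm).intervalIntegrable _ _
  · exact ((Continuous.mul (by fun_prop)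
      (continuous_one_sub_mul_sin_sq_rpow (a - 1) hm)).neg).aestronglyMeasurable
  · refine Filter.Eventually.of_forall fun θ hθ x hx => hC (x, θ) ⟨Set.Ioo_subset_Icc_self hx, ?_⟩
    rw [Set.uIoc_of_le (by positivity)] at hθ
    exact Set.Ioc_subset_Icc_self hθ
  · exact intervalIntegrable_const
  · refine Filter.Eventually.of_forall fun θ _ x hx => ?_
    have hpos := one_sub_mul_sin_sq_pos (hlt x (Set.Ioo_subset_Icc_self hx)) θ
    have h1 : HasDerivAt (fun x : ℝ => 1 - x * Real.sin θ ^ 2) (-(1 * Real.sin θ ^ 2)) x :=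
      ((hasDerivAt_id x).mul_const _).const_sub 1
    refine (h1.rpow_const (p := a) (Or.inl hpos.ne')).congr_deriv ?_
    ring

/-- The derivative exists on all of (-1, 1), so the endpoint 0 needs no separate argument. -/
theorem continuousOn_ellipticPow (a : ℝ) : ContinuousOn (ellipticPow a) (Set.Ico 0 1) :=
  fun _ hm => (hasDerivAt_ellipticPow a (by linarith [hm.1]) hm.2).continuousAt.continuousWithinAt

/-- The derivative of `ellipticPow a` in terms of `ellipticPow a` and `ellipticPow (a - 1)`. -/
theorem hasDerivAt_ellipticPow_sub (a : ℝ) {m : ℝ} (hm0 : 0 < m) (hm : m < 1) :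
    HasDerivAt (ellipticPow a) (a * (ellipticPow a m - ellipticPow (a - 1) m) / m) m := by
  convert hasDerivAt_ellipticPow a (by linarith : -1 < m) hm using 1
  rw [ellipticPow, ellipticPow, ← intervalIntegral.integral_sub
    ((continuous_one_sub_mul_sin_sq_rpow _ hm).intervalIntegrable _ _)
    ((continuous_one_sub_mul_sin_sq_rpow _ hm).intervalIntegrable _ _),
    ← intervalIntegral.integral_const_mul, ← intervalIntegral.integral_div]
  congr 1; ext θ
  have hpos := one_sub_mul_sin_sq_pos hm θ
  have h : (1 - m * Real.sin θ ^ 2) ^ a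
      = (1 - m * Real.sin θ ^ 2) ^ (a - 1) * (1 - m * Real.sin θ ^ 2) := by
    rw [← Real.rpow_add_one hpos.ne']; ring_nf
  rw [h]
  field_simp
  ring

/-- Integrating the derivative of `sin θ cos θ / √(1 - m sin² θ)` reduces the exponent `-3/2`. -/
theorem one_sub_mul_ellipticPow_neg_three_halves {m : ℝ} (hm : m < 1) :
    (1 - m) * ellipticPow (-1 / 2 - 1) m = ellipticPow (1 / 2) m := by
  have key : ∀ θ : ℝ, HasDerivAt
      (fun θ => m * (Real.sin θ * Real.cos θ * (1 - m * Real.sin θ ^ 2) ^ (-1 / 2 : ℝ)))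
      ((1 - m * Real.sin θ ^ 2) ^ (1 / 2 : ℝ)
        - (1 - m) * (1 - m * Real.sin θ ^ 2) ^ (-1 / 2 - 1 : ℝ)) θ := by
    intro θ
    have hpos := one_sub_mul_sin_sq_pos hm θ
    have h1 : HasDerivAt (fun θ : ℝ => 1 - m * Real.sin θ ^ 2)
        (-(m * (2 * Real.sin θ * Real.cos θ))) θ := by
      simpa using (((Real.hasDerivAt_sin θ).pow 2).const_mul m).const_sub 1
    have h2 := h1.rpow_const (p := (-1 / 2 : ℝ)) (Or.inl hpos.ne')
    have h3 := ((((Real.hasDerivAt_sin θ).mul (Real.hasDerivAt_cos θ)).mul h2).const_mul m)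
    refine h3.congr_deriv ?_
    have e1 : (1 - m * Real.sin θ ^ 2) ^ (-1 / 2 : ℝ)
        = (1 - m * Real.sin θ ^ 2) ^ (-1 / 2 - 1 : ℝ) * (1 - m * Real.sin θ ^ 2) := by
      rw [← Real.rpow_add_one hpos.ne']; norm_num
    have e2 : (1 - m * Real.sin θ ^ 2) ^ (1 / 2 : ℝ)
        = (1 - m * Real.sin θ ^ 2) ^ (-1 / 2 - 1 : ℝ) * (1 - m * Real.sin θ ^ 2) ^ 2 := by
      rw [← Real.rpow_natCast (1 - m * Real.sin θ ^ 2), ← Real.rpow_add hpos]; norm_num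
    rw [e1, e2]
    have hc : Real.cos θ ^ 2 = 1 - Real.sin θ ^ 2 := by rw [← Real.sin_sq_add_cos_sq θ]; ring
    simp only [Pi.mul_apply]
    linear_combination ((m * (1 - m * Real.sin θ ^ 2) ^ (-1 / 2 - 1 : ℝ))) * hc
  have hi1 := (continuous_one_sub_mul_sin_sq_rpow (1 / 2) hm).intervalIntegrable
    (μ := volume) 0 (Real.pi / 2)
  have hi2 := (continuous_const.mul (continuous_one_sub_mul_sin_sq_rpow (-1 / 2 - 1) hm)
    ).intervalIntegrable (μ := volume) 
    (u := fun θ => (1 - m) * (1 - m * Real.sin θ ^ 2) ^ (-1 / 2 - 1 : ℝ)) 0 (Real.pi / 2)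
  have := intervalIntegral.integral_eq_sub_of_hasDerivAt (fun θ _ => key θ) (hi1.sub hi2)
  rw [intervalIntegral.integral_sub hi1 hi2, intervalIntegral.integral_const_mul] at this
  -- The boundary terms vanish: sin kills the one at 0, cos the one at π/2.
  simp only [Real.sin_zero, Real.cos_pi_div_two] at this
  simp only [ellipticPow]
  linarith

theorem hasDerivAt_ellipticPow_one_half {m : ℝ} (hm0 : 0 < m) (hm : m < 1) :
    HasDerivAt (ellipticPow (1 / 2))
      ((ellipticPow (1 / 2) m - ellipticPow (-1 / 2) m) / (2 * m)) m := by
  convert hasDerivAt_ellipticPow_sub (1 / 2) hm0 hm using 1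
  norm_num
  field_simp

/-- Trading exponent -3/2 for E/(1-m) closes the system: derivatives of E and K are again
combinations of E and K. -/
theorem hasDerivAt_ellipticPow_neg_one_half {m : ℝ} (hm0 : 0 < m) (hm : m < 1) :
    HasDerivAt (ellipticPow (-1 / 2))
      ((ellipticPow (1 / 2) m - (1 - m) * ellipticPow (-1 / 2) m) / (2 * m * (1 - m))) m := by
  convert hasDerivAt_ellipticPow_sub (-1 / 2) hm0 hm using 1
  have : 1 - m ≠ 0 := by linarith
  rw [← one_sub_mul_ellipticPow_neg_three_halves hm]
  field_simp
  ring

/-! ### Positivity by iterated differentiation. -/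

/-- End of the derivative chain. The base lies in (0, 1], so the smaller exponent gives the larger
integrand, strictly so at θ = π/2. -/
theorem ellipticPow_one_half_lt {m : ℝ} (hm0 : 0 < m) (hm : m < 1) :
    ellipticPow (1 / 2) m < ellipticPow (-1 / 2) m := by
  have hle : ∀ θ : ℝ, 1 - m * Real.sin θ ^ 2 ≤ 1 := fun θ => by
    nlinarith [sq_nonneg (Real.sin θ)]
  refine intervalIntegral.integral_lt_integral_of_continuousOn_of_le_of_exists_lt (by positivity)
    (continuous_one_sub_mul_sin_sq_rpow _ hm).continuousOn
    (continuous_one_sub_mul_sin_sq_rpow _ hm).continuousOn (fun θ _ => ?_)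
    ⟨Real.pi / 2, ⟨by positivity, le_rfl⟩, ?_⟩
  · exact Real.rpow_le_rpow_of_exponent_ge (one_sub_mul_sin_sq_pos hm θ) (hle θ) (by norm_num)
  · apply Real.rpow_lt_rpow_of_exponent_gt (one_sub_mul_sin_sq_pos hm _) _ (by norm_num)
    simp [hm0]

theorem pos_of_hasDerivAt_pos_of_eq_zero {f f' : ℝ → ℝ} (hc : ContinuousOn f (Set.Ico 0 1))
    (h0 : f 0 = 0) (hd : ∀ m ∈ Set.Ioo (0 : ℝ) 1, HasDerivAt f (f' m) m)
    (hpos : ∀ m ∈ Set.Ioo (0 : ℝ) 1, 0 < f' m) {m : ℝ} (hm0 : 0 < m) (hm : m < 1) : 0 < f m := by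
  have hmono : StrictMonoOn f (Set.Ico 0 1) := by
    refine strictMonoOn_of_deriv_pos (convex_Ico 0 1) hc fun x hx => ?_
    rw [interior_Ico] at hx
    rw [(hd x hx).deriv]
    exact hpos x hx
  simpa [h0] using hmono ⟨le_rfl, one_pos⟩ ⟨hm0.le, hm⟩ hm0

/-- Its derivative is (3/2)(K - E), and at 0 both integrals equal π/2, so the combination vanishes
there. -/
theorem elliptic_linear_pos {m : ℝ} (hm0 : 0 < m) (hm : m < 1) :
    0 < (2 - m) * ellipticPow (1 / 2) m - 2 * (1 - m) * ellipticPow (-1 / 2) m := by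
  refine pos_of_hasDerivAt_pos_of_eq_zero
    (f := fun m => (2 - m) * ellipticPow (1 / 2) m - 2 * (1 - m) * ellipticPow (-1 / 2) m)
    (f' := fun m => 3 / 2 * (ellipticPow (-1 / 2) m - ellipticPow (1 / 2) m)) ?_ ?_
    (fun x hx => ?_) (fun x hx => ?_) hm0 hm
  · exact ((by fun_prop : ContinuousOn (fun m : ℝ => 2 - m) _).mul (continuousOn_ellipticPow _)).sub
      ((by fun_prop : ContinuousOn (fun m : ℝ => 2 * (1 - m)) _).mul (continuousOn_ellipticPow _))
  · simp only [ellipticPow_zero]; ring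
  · have h1 : x ≠ 0 := hx.1.ne'
    have h2 : 1 - x ≠ 0 := by linarith [hx.2]
    have hE := hasDerivAt_ellipticPow_one_half hx.1 hx.2
    have hK := hasDerivAt_ellipticPow_neg_one_half hx.1 hx.2
    refine ((((hasDerivAt_id x).const_sub 2).mul hE).sub
      ((((hasDerivAt_id x).const_sub 1).const_mul 2).mul hK)).congr_deriv ?_
    simp only [id]
    field_simp
    ring
  · linarith [ellipticPow_one_half_lt hx.1 hx.2]

/-- Its derivative is a positive multiple of the combination in `elliptic_linear_pos`. -/
theorem elliptic_affine_pos {m : ℝ} (hm0 : 0 < m) (hm : m < 1) :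
    0 < (m - 8) * ellipticPow (1 / 2) m + (8 - 5 * m) * ellipticPow (-1 / 2) m := by
  refine pos_of_hasDerivAt_pos_of_eq_zero
    (f := fun m => (m - 8) * ellipticPow (1 / 2) m + (8 - 5 * m) * ellipticPow (-1 / 2) m)
    (f' := fun m => 3 / (2 * (1 - m)) *
      ((2 - m) * ellipticPow (1 / 2) m - 2 * (1 - m) * ellipticPow (-1 / 2) m)) ?_ ?_
    (fun x hx => ?_) (fun x hx => ?_) hm0 hm
  · exact ((by fun_prop : ContinuousOn (fun m : ℝ => m - 8) _).mul (continuousOn_ellipticPow _)).add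
      ((by fun_prop : ContinuousOn (fun m : ℝ => 8 - 5 * m) _).mul (continuousOn_ellipticPow _))
  · simp only [ellipticPow_zero]; ring
  · have h1 : x ≠ 0 := hx.1.ne'
    have h2 : 1 - x ≠ 0 := by linarith [hx.2]
    have hE := hasDerivAt_ellipticPow_one_half hx.1 hx.2
    have hK := hasDerivAt_ellipticPow_neg_one_half hx.1 hx.2
    refine ((((hasDerivAt_id x).sub_const 8).mul hE).add
      ((((hasDerivAt_id x).const_mul 5).const_sub 8).mul hK)).congr_deriv ?_
    simp only [id]
    field_simp
    ring
  · have : 0 < 1 - x := by linarith [hx.2]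
    have := elliptic_linear_pos hx.1 hx.2
    positivity

/-- This is the bracket of `V4` written in m = 1 - y²; its derivative is 5/2 times the combination
in `elliptic_affine_pos`. -/
theorem elliptic_quadratic_pos {m : ℝ} (hm0 : 0 < m) (hm : m < 1) :
    0 < (16 - 16 * m + m ^ 2) * ellipticPow (1 / 2) m
      - 8 * (1 - m) * (2 - m) * ellipticPow (-1 / 2) m := by
  refine pos_of_hasDerivAt_pos_of_eq_zero
    (f := fun m => (16 - 16 * m + m ^ 2) * ellipticPow (1 / 2) m
      - 8 * (1 - m) * (2 - m) * ellipticPow (-1 / 2) m)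
    (f' := fun m => 5 / 2 *
      ((m - 8) * ellipticPow (1 / 2) m + (8 - 5 * m) * ellipticPow (-1 / 2) m)) ?_ ?_
    (fun x hx => ?_) (fun x hx => ?_) hm0 hm
  · exact ((by fun_prop : ContinuousOn (fun m : ℝ => 16 - 16 * m + m ^ 2) _).mul
      (continuousOn_ellipticPow _)).sub
      ((by fun_prop : ContinuousOn (fun m : ℝ => 8 * (1 - m) * (2 - m)) _).mul
        (continuousOn_ellipticPow _))
  · simp only [ellipticPow_zero]; ring
  · have h1 : x ≠ 0 := hx.1.ne'
    have h2 : 1 - x ≠ 0 := by linarith [hx.2]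
    have hE := hasDerivAt_ellipticPow_one_half hx.1 hx.2
    have hK := hasDerivAt_ellipticPow_neg_one_half hx.1 hx.2
    refine ((((((hasDerivAt_id x).const_mul 16).const_sub 16).add (hasDerivAt_pow 2 x)).mul hE).sub
      (((((hasDerivAt_id x).const_sub 1).const_mul 8).mul
        ((hasDerivAt_id x).const_sub 2)).mul hK)).congr_deriv ?_
    simp only [id, Pi.add_apply, Pi.mul_apply]
    field_simp
    ring
  · have := elliptic_affine_pos hx.1 hx.2
    positivity

/-! ### The weight in the variable y. -/

/-- `V4` in the variable `y = √x / 4`. -/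
theorem V4_sixteen_mul_sq {y : ℝ} (hy0 : 0 < y) (hy : y < 1) :
    V4 (16 * y ^ 2) = 16 / (15 * Real.pi ^ 2 * y) *
      ((1 + 14 * y ^ 2 + y ^ 4) * ellipticPow (1 / 2) (1 - y ^ 2)
        - 8 * y ^ 2 * (1 + y ^ 2) * ellipticPow (-1 / 2) (1 - y ^ 2)) := by
  have hs : √(16 * y ^ 2) = 4 * y := by
    rw [show 16 * y ^ 2 = (4 * y) ^ 2 by ring, Real.sqrt_sq (by positivity)]
  have hp : (16 * y ^ 2) ^ (3 / 2 : ℝ) = 64 * y ^ 3 := by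
    rw [show (3 / 2 : ℝ) = 1 / 2 * (3 : ℕ) by norm_num, Real.rpow_mul (by positivity),
      ← Real.sqrt_eq_rpow, hs, Real.rpow_natCast]
    ring
  have hm : 1 - 16 * y ^ 2 / 16 = 1 - y ^ 2 := by ring
  have h0 : 0 ≤ 1 - y ^ 2 := by nlinarith
  have h1 : 1 - y ^ 2 < 1 := by nlinarith
  rw [V4, hs, hp, hm, ellipticE_sqrt h0, ellipticK_sqrt h0 h1]
  field_simp
  ring

theorem V4_pos {x : ℝ} (hx : x ∈ Set.Ioo (0 : ℝ) 16) : 0 < V4 x := by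
  obtain ⟨hx0, hx1⟩ := hx
  have hy0 : 0 < √x / 4 := by positivity
  have hy : √x / 4 < 1 := by
    rw [div_lt_one (by norm_num), Real.sqrt_lt' (by norm_num)]; linarith
  have hxy : x = 16 * (√x / 4) ^ 2 := by rw [div_pow, Real.sq_sqrt hx0.le]; ring
  rw [hxy]
  generalize √x / 4 = y at hy0 hy
  rw [V4_sixteen_mul_sq hy0 hy]
  have h := elliptic_quadratic_pos (m := 1 - y ^ 2) (by nlinarith) (by nlinarith)
  refine mul_pos (by positivity) (h.trans_eq ?_)
  ring

/-! ### Substitutions and factorization of the moments. -/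

theorem image_sin_Ioo : Real.sin '' Set.Ioo 0 (Real.pi / 2) = Set.Ioo 0 1 := by
  have hpi := Real.pi_pos
  apply Set.Subset.antisymm
  · rintro _ ⟨θ, hθ, rfl⟩
    refine ⟨Real.sin_pos_of_pos_of_lt_pi hθ.1 (by linarith [hθ.2]), ?_⟩
    rw [← Real.sin_pi_div_two]
    exact Real.sin_lt_sin_of_lt_of_le_pi_div_two (by linarith [hθ.1]) le_rfl hθ.2
  · simpa using intermediate_value_Ioo (by positivity : (0 : ℝ) ≤ Real.pi / 2)
      Real.continuous_sin.continuousOn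

theorem injOn_sin_Ioo : Set.InjOn Real.sin (Set.Ioo 0 (Real.pi / 2)) :=
  Real.injOn_sin.mono
    (Set.Ioo_subset_Icc_self.trans (Set.Icc_subset_Icc_left (by linarith [Real.pi_pos])))

/-- As θ increases from 0 to π/2, the root decreases strictly from 1 to y. -/
theorem image_sqrt_one_sub_mul_sin_sq {y : ℝ} (hy0 : 0 < y) (hy : y < 1) :
    Set.InjOn (fun θ => √(1 - (1 - y ^ 2) * Real.sin θ ^ 2)) (Set.Ioo 0 (Real.pi / 2)) ∧
    (fun θ => √(1 - (1 - y ^ 2) * Real.sin θ ^ 2)) '' Set.Ioo 0 (Real.pi / 2) = Set.Ioo y 1 := by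
  have hm0 : 0 < 1 - y ^ 2 := by nlinarith
  have hm1 : 1 - y ^ 2 < 1 := by nlinarith
  have hpi := Real.pi_pos
  have hanti : StrictAntiOn (fun θ => √(1 - (1 - y ^ 2) * Real.sin θ ^ 2))
      (Set.Icc 0 (Real.pi / 2)) := by
    intro a ha b hb hab
    refine Real.sqrt_lt_sqrt (one_sub_mul_sin_sq_pos hm1 b).le ?_
    have h1 : Real.sin a < Real.sin b :=
      Real.sin_lt_sin_of_lt_of_le_pi_div_two (by linarith [ha.1]) hb.2 hab
    have h2 : 0 ≤ Real.sin a := Real.sin_nonneg_of_nonneg_of_le_pi ha.1 (by linarith [ha.2])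
    have h3 : Real.sin a ^ 2 < Real.sin b ^ 2 := by nlinarith
    nlinarith
  have h0 : √(1 - (1 - y ^ 2) * Real.sin 0 ^ 2) = 1 := by simp
  have h1 : √(1 - (1 - y ^ 2) * Real.sin (Real.pi / 2) ^ 2) = y := by
    simp [Real.sqrt_sq hy0.le]
  refine ⟨hanti.injOn.mono Set.Ioo_subset_Icc_self, Set.Subset.antisymm ?_ ?_⟩
  · rintro _ ⟨θ, hθ, rfl⟩
    have hθ' := Set.Ioo_subset_Icc_self hθ
    have ha := hanti hθ' ⟨by positivity, le_rfl⟩ hθ.2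
    have hb := hanti ⟨le_rfl, by positivity⟩ hθ' hθ.1
    simp only [h0, h1] at ha hb
    exact ⟨ha, hb⟩
  · have := intermediate_value_Ioo' (by positivity : (0 : ℝ) ≤ Real.pi / 2)
      (f := fun θ => √(1 - (1 - y ^ 2) * Real.sin θ ^ 2)) (by fun_prop)
    simpa only [h0, h1] using this

/-- The substitution `v = √(1 - (1 - y²) sin² θ)` that turns the trigonometric form of an elliptic
integral into its algebraic form. -/
theorem lintegral_comp_sqrt_one_sub_mul_sin_sq {y : ℝ} (hy0 : 0 < y) (hy : y < 1)
    (g : ℝ → ENNReal) :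
    ∫⁻ θ in Set.Ioo 0 (Real.pi / 2), g √(1 - (1 - y ^ 2) * Real.sin θ ^ 2) =
      ∫⁻ v in Set.Ioo y 1, g v * ENNReal.ofReal (v / (√(1 - v ^ 2) * √(v ^ 2 - y ^ 2))) := by
  have hm0 : 0 < 1 - y ^ 2 := by nlinarith
  have hm1 : 1 - y ^ 2 < 1 := by nlinarith
  obtain ⟨hinj, himg⟩ := image_sqrt_one_sub_mul_sin_sq hy0 hy
  have hd : ∀ θ ∈ Set.Ioo 0 (Real.pi / 2),
      HasDerivWithinAt (fun θ => √(1 - (1 - y ^ 2) * Real.sin θ ^ 2))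
        (-((1 - y ^ 2) * (2 * Real.sin θ * Real.cos θ)) /
          (2 * √(1 - (1 - y ^ 2) * Real.sin θ ^ 2))) (Set.Ioo 0 (Real.pi / 2)) θ := by
    intro θ _
    have h1 : HasDerivAt (fun θ : ℝ => 1 - (1 - y ^ 2) * Real.sin θ ^ 2)
        (-((1 - y ^ 2) * (2 * Real.sin θ * Real.cos θ))) θ := by
      simpa using (((Real.hasDerivAt_sin θ).pow 2).const_mul (1 - y ^ 2)).const_sub 1
    exact (h1.sqrt (one_sub_mul_sin_sq_pos hm1 θ).ne').hasDerivWithinAt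
  rw [← himg, lintegral_image_eq_lintegral_abs_deriv_mul measurableSet_Ioo hd hinj]
  refine setLIntegral_congr_fun measurableSet_Ioo fun θ hθ => ?_
  have hs : 0 < Real.sin θ :=
    Real.sin_pos_of_pos_of_lt_pi hθ.1 (by linarith [hθ.2, Real.pi_pos])
  have hc : 0 < Real.cos θ := Real.cos_pos_of_mem_Ioo ⟨by linarith [hθ.1, Real.pi_pos], hθ.2⟩
  have hD := one_sub_mul_sin_sq_pos hm1 θ
  have hD' : 0 < √(1 - (1 - y ^ 2) * Real.sin θ ^ 2) := Real.sqrt_pos.2 hD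
  have hk : √(1 - y ^ 2) ^ 2 = 1 - y ^ 2 := Real.sq_sqrt hm0.le
  have hk0 : 0 < √(1 - y ^ 2) := Real.sqrt_pos.2 hm0
  have e1 : √(1 - √(1 - (1 - y ^ 2) * Real.sin θ ^ 2) ^ 2) = √(1 - y ^ 2) * Real.sin θ := by
    rw [Real.sq_sqrt hD.le, Real.sqrt_eq_iff_mul_self_eq_of_pos (by positivity)]
    linear_combination Real.sin θ ^ 2 * hk
  have e2 : √(√(1 - (1 - y ^ 2) * Real.sin θ ^ 2) ^ 2 - y ^ 2) = √(1 - y ^ 2) * Real.cos θ := by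
    rw [Real.sq_sqrt hD.le, Real.sqrt_eq_iff_mul_self_eq_of_pos (by positivity)]
    linear_combination Real.cos θ ^ 2 * hk + (1 - y ^ 2) * Real.sin_sq_add_cos_sq θ
  rw [e1, e2, mul_left_comm, ← ENNReal.ofReal_mul (abs_nonneg _)]
  -- The Jacobian is exactly the reciprocal of the algebraic kernel.
  have : |-((1 - y ^ 2) * (2 * Real.sin θ * Real.cos θ)) /
          (2 * √(1 - (1 - y ^ 2) * Real.sin θ ^ 2))| *
        (√(1 - (1 - y ^ 2) * Real.sin θ ^ 2) /
          (√(1 - y ^ 2) * Real.sin θ * (√(1 - y ^ 2) * Real.cos θ))) = 1 := by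
    rw [neg_div, abs_neg, abs_of_pos (by positivity)]
    field_simp
    rw [hk]
  rw [this]
  simp

/-- The scaling y = v sin β pulls out v^s and leaves a constant independent of v. -/
theorem lintegral_pow_div_sqrt_sub_sq (s : ℕ) {v : ℝ} (hv : 0 < v) :
    ∫⁻ y in Set.Ioo 0 v, ENNReal.ofReal (y ^ s / √(v ^ 2 - y ^ 2)) =
      ENNReal.ofReal (v ^ s) *
        ∫⁻ β in Set.Ioo 0 (Real.pi / 2), ENNReal.ofReal (Real.sin β ^ s) := by
  have himg : (fun β => v * Real.sin β) '' Set.Ioo 0 (Real.pi / 2) = Set.Ioo 0 v := by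
    rw [← Set.image_image (fun t => v * t), image_sin_Ioo, Set.image_mul_left_Ioo hv]
    simp
  rw [← himg, lintegral_image_eq_lintegral_abs_deriv_mul measurableSet_Ioo
    (fun β _ => ((Real.hasDerivAt_sin β).const_mul v).hasDerivWithinAt)
    (fun a ha b hb hab => injOn_sin_Ioo ha hb (mul_left_cancel₀ hv.ne' hab)),
    ← lintegral_const_mul' _ _ ENNReal.ofReal_ne_top]
  refine setLIntegral_congr_fun measurableSet_Ioo fun β hβ => ?_
  have hc : 0 < Real.cos β := Real.cos_pos_of_mem_Ioo ⟨by linarith [hβ.1, Real.pi_pos], hβ.2⟩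
  have e : √(v ^ 2 - (v * Real.sin β) ^ 2) = v * Real.cos β := by
    rw [Real.sqrt_eq_iff_mul_self_eq_of_pos (by positivity)]
    linear_combination v ^ 2 * Real.sin_sq_add_cos_sq β
  rw [e, ← ENNReal.ofReal_mul (abs_nonneg _), ← ENNReal.ofReal_mul (by positivity),
    abs_of_pos (by positivity)]
  congr 1
  field_simp
  exact mul_pow _ _ _

theorem lintegral_mul_div_sqrt_one_sub_sq (g : ℝ → ENNReal) :
    ∫⁻ v in Set.Ioo 0 1, g v * ENNReal.ofReal (1 / √(1 - v ^ 2)) =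
      ∫⁻ α in Set.Ioo 0 (Real.pi / 2), g (Real.sin α) := by
  rw [← image_sin_Ioo, lintegral_image_eq_lintegral_abs_deriv_mul measurableSet_Ioo
    (fun β _ => (Real.hasDerivAt_sin β).hasDerivWithinAt) injOn_sin_Ioo]
  refine setLIntegral_congr_fun measurableSet_Ioo fun β hβ => ?_
  have hc : 0 < Real.cos β := Real.cos_pos_of_mem_Ioo ⟨by linarith [hβ.1, Real.pi_pos], hβ.2⟩
  have e : √(1 - Real.sin β ^ 2) = Real.cos β := by
    rw [Real.sqrt_eq_iff_mul_self_eq_of_pos hc]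
    linear_combination Real.sin_sq_add_cos_sq β
  rw [e, mul_left_comm, ← ENNReal.ofReal_mul (abs_nonneg _), abs_of_pos hc,
    mul_one_div_cancel hc.ne']
  simp

/-- Moments of a general elliptic integral factor as a product of two trigonometric integrals. -/
theorem lintegral_pow_mul_lintegral_comp (s : ℕ) {g : ℝ → ENNReal} (hg : Measurable g) :
    ∫⁻ y in Set.Ioo (0 : ℝ) 1, ENNReal.ofReal (y ^ s) *
        ∫⁻ θ in Set.Ioo 0 (Real.pi / 2), g √(1 - (1 - y ^ 2) * Real.sin θ ^ 2) =
      (∫⁻ α in Set.Ioo 0 (Real.pi / 2),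
        g (Real.sin α) * ENNReal.ofReal (Real.sin α ^ (s + 1))) *
      ∫⁻ β in Set.Ioo 0 (Real.pi / 2), ENNReal.ofReal (Real.sin β ^ s) := by
  set c := ∫⁻ β in Set.Ioo 0 (Real.pi / 2), ENNReal.ofReal (Real.sin β ^ s) with hc
  let F : ℝ → ℝ → ENNReal := fun y v => ENNReal.ofReal (y ^ s) *
    (g v * ENNReal.ofReal (v / (√(1 - v ^ 2) * √(v ^ 2 - y ^ 2))))
  have hF : Measurable (Function.uncurry F) := by
    have : Measurable fun p : ℝ × ℝ => g p.2 := hg.comp measurable_snd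
    unfold F Function.uncurry
    exact Measurable.mul (by fun_prop) (Measurable.mul this (by fun_prop))
  -- The indicator of the triangle y < v puts both orders of integration on the fixed square (0,1)².
  -- Values in `ENNReal` allow the swap without prior integrability.
  let T : Set (ℝ × ℝ) := {p | p.1 < p.2}
  have hT : MeasurableSet T := measurableSet_lt measurable_fst measurable_snd
  have hleft : ∀ y ∈ Set.Ioo (0 : ℝ) 1, ENNReal.ofReal (y ^ s) *
        ∫⁻ θ in Set.Ioo 0 (Real.pi / 2), g √(1 - (1 - y ^ 2) * Real.sin θ ^ 2) =
      ∫⁻ v in Set.Ioo (0 : ℝ) 1, T.indicator (Function.uncurry F) (y, v) := by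
    intro y hy
    rw [lintegral_comp_sqrt_one_sub_mul_sin_sq hy.1 hy.2,
      ← lintegral_const_mul' _ _ ENNReal.ofReal_ne_top]
    have : ∀ v, T.indicator (Function.uncurry F) (y, v) = (Set.Ioi y).indicator (F y) v :=
      fun v => rfl
    simp_rw [this]
    rw [setLIntegral_indicator measurableSet_Ioi]
    congr 2
    ext v
    simp only [Set.mem_Ioo, Set.mem_inter_iff, Set.mem_Ioi]
    have := hy.1
    grind
  have hright : ∀ v ∈ Set.Ioo (0 : ℝ) 1,
      ∫⁻ y in Set.Ioo (0 : ℝ) 1, T.indicator (Function.uncurry F) (y, v) =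
        (g v * ENNReal.ofReal (v ^ (s + 1)) * c) * ENNReal.ofReal (1 / √(1 - v ^ 2)) := by
    intro v hv
    have : ∀ y, T.indicator (Function.uncurry F) (y, v) =
        (Set.Iio v).indicator (fun y => F y v) y := fun y => rfl
    simp_rw [this]
    rw [setLIntegral_indicator measurableSet_Iio]
    have hset : Set.Iio v ∩ Set.Ioo 0 1 = Set.Ioo 0 v := by
      ext y
      simp only [Set.mem_Ioo, Set.mem_inter_iff, Set.mem_Iio]
      have := hv.2
      grind
    rw [hset]
    have hfun : ∀ y ∈ Set.Ioo 0 v, F y v = (g v * ENNReal.ofReal (v / √(1 - v ^ 2))) *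
        ENNReal.ofReal (y ^ s / √(v ^ 2 - y ^ 2)) := by
      intro y hy
      have := hv.1
      have := hy.1
      simp only [F]
      rw [mul_left_comm, mul_assoc, ← ENNReal.ofReal_mul (by positivity),
        ← ENNReal.ofReal_mul (by positivity)]
      congr 2
      rw [div_mul_div_comm, mul_div_assoc', mul_comm (y ^ s)]
    rw [setLIntegral_congr_fun measurableSet_Ioo hfun, lintegral_const_mul _ (by fun_prop),
      lintegral_pow_div_sqrt_sub_sq s hv.1, ← hc]
    have h0 := hv.1
    have : ENNReal.ofReal (v / √(1 - v ^ 2)) * ENNReal.ofReal (v ^ s) =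
        ENNReal.ofReal (v ^ (s + 1)) * ENNReal.ofReal (1 / √(1 - v ^ 2)) := by
      rw [← ENNReal.ofReal_mul (by positivity), ← ENNReal.ofReal_mul (by positivity)]
      congr 1
      ring
    calc _ = g v * (ENNReal.ofReal (v / √(1 - v ^ 2)) * ENNReal.ofReal (v ^ s)) * c := by ring
      _ = _ := by rw [this]; ring
  rw [setLIntegral_congr_fun measurableSet_Ioo hleft,
    lintegral_lintegral_swap (f := fun y v => T.indicator (Function.uncurry F) (y, v))
      (hF.indicator hT).aemeasurable,
    setLIntegral_congr_fun measurableSet_Ioo hright, lintegral_mul_div_sqrt_one_sub_sq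
      (fun v => g v * ENNReal.ofReal (v ^ (s + 1)) * c),
    lintegral_mul_const]
  exact Measurable.mul (hg.comp Real.measurable_sin) (by fun_prop)

/-! ### Moments of E and K as products of Wallis integrals. -/

/-- Wallis' integral `∫₀^{π/2} sin^s`. -/
noncomputable def wallis (s : ℕ) : ℝ := ∫ θ in (0 : ℝ)..(Real.pi / 2), Real.sin θ ^ s

theorem wallis_zero : wallis 0 = Real.pi / 2 := by simp [wallis]

theorem wallis_add_two (s : ℕ) : wallis (s + 2) = (s + 1) / (s + 2) * wallis s := by
  simp [wallis, integral_sin_pow]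

theorem sin_nonneg_of_mem_Ioo {θ : ℝ} (hθ : θ ∈ Set.Ioo 0 (Real.pi / 2)) : 0 ≤ Real.sin θ :=
  Real.sin_nonneg_of_nonneg_of_le_pi hθ.1.le (by linarith [hθ.2, Real.pi_pos])

theorem wallis_nonneg (s : ℕ) : 0 ≤ wallis s := by
  refine intervalIntegral.integral_nonneg (by positivity) fun θ hθ => pow_nonneg ?_ s
  exact Real.sin_nonneg_of_nonneg_of_le_pi hθ.1 (by linarith [hθ.2, Real.pi_pos])

theorem lintegral_ofReal_Ioo_eq {f : ℝ → ℝ} (hf : Continuous f)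
    (h0 : ∀ θ ∈ Set.Ioo 0 (Real.pi / 2), 0 ≤ f θ) :
    ∫⁻ θ in Set.Ioo 0 (Real.pi / 2), ENNReal.ofReal (f θ) =
      ENNReal.ofReal (∫ θ in (0 : ℝ)..(Real.pi / 2), f θ) := by
  rw [intervalIntegral.integral_of_le (by positivity), integral_Ioc_eq_integral_Ioo,
    ofReal_integral_eq_lintegral_ofReal]
  · exact (hf.integrableOn_Icc (a := 0) (b := Real.pi / 2)).mono_set Set.Ioo_subset_Icc_self
  · exact (ae_restrict_iff' measurableSet_Ioo).2 (Filter.Eventually.of_forall h0)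

theorem lintegral_sin_pow (s : ℕ) :
    ∫⁻ θ in Set.Ioo 0 (Real.pi / 2), ENNReal.ofReal (Real.sin θ ^ s) =
      ENNReal.ofReal (wallis s) :=
  lintegral_ofReal_Ioo_eq (by fun_prop) fun _ hθ => pow_nonneg (sin_nonneg_of_mem_Ioo hθ) s

theorem ellipticPow_nonneg (a : ℝ) {m : ℝ} (hm : m < 1) : 0 ≤ ellipticPow a m :=
  intervalIntegral.integral_nonneg (by positivity) fun θ _ =>
    Real.rpow_nonneg (one_sub_mul_sin_sq_pos hm θ).le a

/-- Take g(v) = v^(2a) in the factorization. The hypothesis `h` encodes t = 2a + s + 1 while keeping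
the real exponent 2a and the natural exponents apart. -/
theorem lintegral_ofReal_pow_mul_ellipticPow (s : ℕ) (a : ℝ) (t : ℕ)
    (h : ∀ v : ℝ, 0 < v → v ^ (2 * a) * v ^ (s + 1) = v ^ t) :
    ∫⁻ y in Set.Ioo (0 : ℝ) 1, ENNReal.ofReal (y ^ s * ellipticPow a (1 - y ^ 2)) =
      ENNReal.ofReal (wallis t * wallis s) := by
  have hpt : ∀ y ∈ Set.Ioo (0 : ℝ) 1, ENNReal.ofReal (y ^ s * ellipticPow a (1 - y ^ 2)) =
      ENNReal.ofReal (y ^ s) * ∫⁻ θ in Set.Ioo 0 (Real.pi / 2),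
        ENNReal.ofReal (√(1 - (1 - y ^ 2) * Real.sin θ ^ 2) ^ (2 * a)) := by
    intro y hy
    have hm : 1 - y ^ 2 < 1 := by nlinarith [hy.1]
    rw [ENNReal.ofReal_mul (pow_nonneg hy.1.le s), ellipticPow, ← lintegral_ofReal_Ioo_eq
      (continuous_one_sub_mul_sin_sq_rpow a hm)
      (fun θ _ => Real.rpow_nonneg (one_sub_mul_sin_sq_pos hm θ).le a)]
    congr 1
    refine lintegral_congr fun θ => ?_
    rw [Real.sqrt_eq_rpow, ← Real.rpow_mul (one_sub_mul_sin_sq_pos hm θ).le]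
    congr 2
    ring
  rw [setLIntegral_congr_fun measurableSet_Ioo hpt,
    lintegral_pow_mul_lintegral_comp s (g := fun v => ENNReal.ofReal (v ^ (2 * a))) (by fun_prop),
    ENNReal.ofReal_mul (wallis_nonneg t), ← lintegral_sin_pow s, ← lintegral_sin_pow t]
  congr 1
  refine setLIntegral_congr_fun measurableSet_Ioo fun θ hθ => ?_
  have hs : 0 < Real.sin θ :=
    Real.sin_pos_of_pos_of_lt_pi hθ.1 (by linarith [hθ.2, Real.pi_pos])
  rw [← ENNReal.ofReal_mul (by positivity), h _ hs]

/-- The integrand is nonnegative, so the finite value of the Lebesgue integral gives integrability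
as well as the integral. -/
theorem integral_pow_mul_ellipticPow (s : ℕ) (a : ℝ) (t : ℕ)
    (h : ∀ v : ℝ, 0 < v → v ^ (2 * a) * v ^ (s + 1) = v ^ t) :
    IntegrableOn (fun y => y ^ s * ellipticPow a (1 - y ^ 2)) (Set.Ioo 0 1) ∧
      ∫ y in Set.Ioo (0 : ℝ) 1, y ^ s * ellipticPow a (1 - y ^ 2) = wallis t * wallis s := by
  have hl := lintegral_ofReal_pow_mul_ellipticPow s a t h
  have hnn : 0 ≤ᵐ[volume.restrict (Set.Ioo (0 : ℝ) 1)]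
      fun y => y ^ s * ellipticPow a (1 - y ^ 2) :=
    (ae_restrict_iff' measurableSet_Ioo).2 (Filter.Eventually.of_forall fun y hy =>
      mul_nonneg (pow_nonneg hy.1.le s) (ellipticPow_nonneg a (by nlinarith [hy.1])))
  have hmeas : AEStronglyMeasurable (fun y => y ^ s * ellipticPow a (1 - y ^ 2))
      (volume.restrict (Set.Ioo (0 : ℝ) 1)) := by
    refine ContinuousOn.aestronglyMeasurable ?_ measurableSet_Ioo
    refine ContinuousOn.mul (by fun_prop)
      ((continuousOn_ellipticPow a).comp (by fun_prop) fun y hy => ?_)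
    exact ⟨by nlinarith [hy.1, hy.2], by nlinarith [hy.1]⟩
  refine ⟨⟨hmeas, ?_⟩, ?_⟩
  · rw [hasFiniteIntegral_iff_ofReal hnn, hl]
    exact ENNReal.ofReal_lt_top
  · rw [integral_eq_lintegral_of_nonneg_ae hnn hmeas, hl,
      ENNReal.toReal_ofReal (mul_nonneg (wallis_nonneg t) (wallis_nonneg s))]

theorem integral_pow_mul_ellipticPow_neg_one_half (s : ℕ) :
    IntegrableOn (fun y => y ^ s * ellipticPow (-1 / 2) (1 - y ^ 2)) (Set.Ioo 0 1) ∧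
      ∫ y in Set.Ioo (0 : ℝ) 1, y ^ s * ellipticPow (-1 / 2) (1 - y ^ 2) =
        wallis s * wallis s := by
  refine integral_pow_mul_ellipticPow s (-1 / 2) s fun v hv => ?_
  rw [show (2 * (-1 / 2) : ℝ) = -1 by norm_num, Real.rpow_neg_one]
  field_simp
  ring

theorem integral_pow_mul_ellipticPow_one_half (s : ℕ) :
    IntegrableOn (fun y => y ^ s * ellipticPow (1 / 2) (1 - y ^ 2)) (Set.Ioo 0 1) ∧
      ∫ y in Set.Ioo (0 : ℝ) 1, y ^ s * ellipticPow (1 / 2) (1 - y ^ 2) =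
        wallis (s + 2) * wallis s := by
  refine integral_pow_mul_ellipticPow s (1 / 2) (s + 2) fun v hv => ?_
  rw [show (2 * (1 / 2) : ℝ) = 1 by norm_num, Real.rpow_one]
  ring

theorem wallis_two_mul (n : ℕ) :
    wallis (2 * n) = Real.pi / 2 * (2 * n).factorial / (4 ^ n * (n.factorial : ℝ) ^ 2) := by
  induction n with
  | zero => simp [wallis_zero]
  | succ n ih =>
    rw [show 2 * (n + 1) = 2 * n + 2 by ring, wallis_add_two, ih]
    simp only [Nat.factorial_succ]
    push_cast
    field_simp
    ring

/-- The combination of products of Wallis integrals that gives the moments of `V4`. -/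
theorem wallis_combination_eq_D4 (n : ℕ) :
    16 ^ n * 512 / (15 * Real.pi ^ 2) *
      (wallis (2 * n + 2) * wallis (2 * n)
        + 14 * (wallis (2 * n + 4) * wallis (2 * n + 2))
        + wallis (2 * n + 6) * wallis (2 * n + 4)
        - 8 * (wallis (2 * n + 2) * wallis (2 * n + 2))
        - 8 * (wallis (2 * n + 4) * wallis (2 * n + 4))) = D4 n := by
  have h2 := wallis_add_two (2 * n)
  have h4 := wallis_add_two (2 * n + 2)
  have h6 := wallis_add_two (2 * n + 4)
  -- The recurrence makes every product a rational multiple of `wallis (2 * n)` squared; its π² and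
  -- 4^n · 4^n cancel against the prefactor.
  rw [h6, h4, h2, wallis_two_mul, D4]
  have h16 : (16 : ℝ) ^ n = 4 ^ n * 4 ^ n := by rw [← mul_pow]; norm_num
  rw [h16]
  simp only [Finset.prod_range_succ, Finset.prod_range_zero, Nat.factorial_succ, add_zero, one_mul]
  push_cast
  have hn : (0 : ℝ) ≤ n := n.cast_nonneg
  field_simp
  ring

/-! ### The moments of the weight. -/

theorem image_sixteen_mul_sq :
    (fun y : ℝ => 16 * y ^ 2) '' Set.Ioo 0 1 = Set.Ioo 0 16 := by
  apply Set.Subset.antisymm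
  · rintro _ ⟨y, ⟨h0, h1⟩, rfl⟩
    exact ⟨by positivity, by dsimp only; nlinarith⟩
  · have := intermediate_value_Ioo (zero_le_one : (0 : ℝ) ≤ 1)
      (f := fun y : ℝ => 16 * y ^ 2) (by fun_prop)
    norm_num at this
    exact this

theorem solvesMomentProblem_V4 : SolvesMomentProblem V4 := by
  intro n
  have hinj : Set.InjOn (fun y : ℝ => 16 * y ^ 2) (Set.Ioo 0 1) := by
    intro a ha b hb hab
    have : a ^ 2 = b ^ 2 := by simpa using hab
    exact (sq_eq_sq₀ ha.1.le hb.1.le).1 this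
  have hd : ∀ y ∈ Set.Ioo (0 : ℝ) 1,
      HasDerivWithinAt (fun y : ℝ => 16 * y ^ 2) (32 * y) (Set.Ioo 0 1) y := fun y _ =>
    (((hasDerivAt_pow 2 y).const_mul 16).congr_deriv (by norm_num; ring)).hasDerivWithinAt
  -- The Jacobian 32y cancels the factor 1/y of the weight, leaving 32 · 16 = 512 and only even
  -- powers of y.
  have hcongr : Set.EqOn (fun y => |32 * y| • ((16 * y ^ 2) ^ n * V4 (16 * y ^ 2)))
      (fun y => 16 ^ n * 512 / (15 * Real.pi ^ 2) *
        (y ^ (2 * n) * ellipticPow (1 / 2) (1 - y ^ 2)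
          + 14 * (y ^ (2 * n + 2) * ellipticPow (1 / 2) (1 - y ^ 2))
          + y ^ (2 * n + 4) * ellipticPow (1 / 2) (1 - y ^ 2)
          - 8 * (y ^ (2 * n + 2) * ellipticPow (-1 / 2) (1 - y ^ 2))
          - 8 * (y ^ (2 * n + 4) * ellipticPow (-1 / 2) (1 - y ^ 2)))) (Set.Ioo 0 1) := by
    intro y hy
    have h0 := hy.1
    simp only [smul_eq_mul]
    rw [V4_sixteen_mul_sq hy.1 hy.2, abs_of_pos (by positivity), mul_pow, ← pow_mul]
    field_simp
    ring
  obtain ⟨i1, e1⟩ := integral_pow_mul_ellipticPow_one_half (2 * n)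
  obtain ⟨i2, e2⟩ := integral_pow_mul_ellipticPow_one_half (2 * n + 2)
  obtain ⟨i3, e3⟩ := integral_pow_mul_ellipticPow_one_half (2 * n + 4)
  obtain ⟨i4, e4⟩ := integral_pow_mul_ellipticPow_neg_one_half (2 * n + 2)
  obtain ⟨i5, e5⟩ := integral_pow_mul_ellipticPow_neg_one_half (2 * n + 4)
  have i12 := i1.add (i2.const_mul 14)
  have i13 := i12.add i3
  have i14 := i13.sub (i4.const_mul 8)
  have i15 := i14.sub (i5.const_mul 8)
  constructor
  · rw [intervalIntegrable_iff_integrableOn_Ioo_of_le (by norm_num), ← image_sixteen_mul_sq,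
      integrableOn_image_iff_integrableOn_abs_deriv_smul measurableSet_Ioo hd hinj,
      integrableOn_congr_fun hcongr measurableSet_Ioo]
    exact i15.const_mul _
  · rw [intervalIntegral.integral_of_le (by norm_num), integral_Ioc_eq_integral_Ioo,
      ← image_sixteen_mul_sq,
      integral_image_eq_integral_abs_deriv_smul measurableSet_Ioo hd hinj,
      setIntegral_congr_fun measurableSet_Ioo hcongr, integral_const_mul]
    rw [integral_sub (by exact i14) (by exact i5.const_mul 8),
      integral_sub (by exact i13) (by exact i4.const_mul 8), integral_add (by exact i12) i3,
      integral_add i1 (by exact i2.const_mul 14), integral_const_mul, integral_const_mul,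
      integral_const_mul, e1, e2, e3, e4, e5]
    exact wallis_combination_eq_D4 n

/-! ### Uniqueness. -/

/-- An integrable function on a compact interval all of whose moments vanish is null. -/
theorem ae_eq_zero_of_moments_eq_zero {a b : ℝ} (hab : a ≤ b) {f : ℝ → ℝ}
    (hf : IntervalIntegrable f volume a b)
    (hmom : ∀ n : ℕ, ∫ x in a..b, x ^ n * f x = 0) :
    ∀ᵐ x ∂(volume.restrict (Set.Icc a b)), f x = 0 := by
  have hpolyint : ∀ p : Polynomial ℝ, IntervalIntegrable (fun x => p.eval x * f x) volume a b :=
    fun p => hf.continuousOn_mul p.continuous.continuousOn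
  have hpoly : ∀ p : Polynomial ℝ, ∫ x in a..b, p.eval x * f x = 0 := by
    intro p
    induction p using Polynomial.induction_on' with
    | add p q hp hq =>
      simp only [Polynomial.eval_add, add_mul]
      rw [intervalIntegral.integral_add (hpolyint p) (hpolyint q), hp, hq, add_zero]
    | monomial n c =>
      simp only [Polynomial.eval_monomial, mul_assoc]
      rw [intervalIntegral.integral_const_mul, hmom, mul_zero]
  have hcont : ∀ g : ℝ → ℝ, Continuous g → ∫ x in a..b, g x * f x = 0 := by
    intro g hg
    have hgint : IntervalIntegrable (fun x => g x * f x) volume a b :=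
      hf.continuousOn_mul hg.continuousOn
    have hC : 0 ≤ ∫ x in a..b, |f x| :=
      intervalIntegral.integral_nonneg hab fun x _ => abs_nonneg _
    have hbound : ∀ ε > 0, |∫ x in a..b, g x * f x| ≤ ε * ∫ x in a..b, |f x| := by
      intro ε hε
      obtain ⟨p, hp⟩ := exists_polynomial_near_of_continuousOn a b g hg.continuousOn ε hε
      rw [show ∫ x in a..b, g x * f x = ∫ x in a..b, (g x * f x - p.eval x * f x) by
        rw [intervalIntegral.integral_sub hgint (hpolyint p), hpoly p, sub_zero],
        ← intervalIntegral.integral_const_mul]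
      refine (intervalIntegral.abs_integral_le_integral_abs hab).trans
        (intervalIntegral.integral_mono_on hab (hgint.sub (hpolyint p)).abs
          (hf.abs.const_mul ε) fun x hx => ?_)
      rw [← sub_mul, abs_mul, abs_sub_comm]
      exact mul_le_mul_of_nonneg_right (hp x hx).le (abs_nonneg _)
    by_contra hne
    have hpos : 0 < |∫ x in a..b, g x * f x| := abs_pos.2 hne
    -- This ε makes the bound at most half of the supposedly nonzero value; the +1 avoids division
    -- by zero.
    have := hbound (|∫ x in a..b, g x * f x| / (2 * ((∫ x in a..b, |f x|) + 1))) (by positivity)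
    rw [div_mul_eq_mul_div, le_div_iff₀ (by positivity)] at this
    nlinarith
  have hloc : LocallyIntegrableOn f (Set.Ioo a b) :=
    ((intervalIntegrable_iff_integrableOn_Ioo_of_le hab).1 hf).locallyIntegrableOn
  -- Smooth test functions supported in (a, b) are continuous, so their full integrals against f
  -- reduce to the interval and vanish.
  have hae := isOpen_Ioo.ae_eq_zero_of_integral_contDiff_smul_eq_zero hloc
    (fun g hg _ hsupp => by
      rw [← hcont g hg.continuous, intervalIntegral.integral_of_le hab,
        integral_Ioc_eq_integral_Ioo, setIntegral_eq_integral_of_forall_compl_eq_zero]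
      · rfl
      · intro x hx
        rw [image_eq_zero_of_notMem_tsupport fun h => hx (hsupp h), zero_mul])
  rw [← restrict_Ioo_eq_restrict_Icc, ae_restrict_iff' measurableSet_Ioo]
  exact hae

theorem SolvesMomentProblem.ae_eq {V W : ℝ → ℝ} (hV : SolvesMomentProblem V)
    (hW : SolvesMomentProblem W) :
    ∀ᵐ x ∂(volume.restrict (Set.Icc (0 : ℝ) 16)), W x = V x := by
  -- Integrability of the function itself is the case n = 0.
  have hint : ∀ {U : ℝ → ℝ}, SolvesMomentProblem U → IntervalIntegrable U volume 0 16 :=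
    fun hU => by simpa using (hU 0).1
  have := ae_eq_zero_of_moments_eq_zero (by norm_num) ((hint hW).sub (hint hV)) fun n => by
    simp only [mul_sub]
    rw [intervalIntegral.integral_sub (hW n).1 (hV n).1, (hW n).2, (hV n).2, sub_self]
  filter_upwards [this] with x hx using sub_eq_zero.1 hx

theorem mainTheorem4 :
    SolvesMomentProblem V4 ∧
    (∀ x ∈ Set.Ioo (0 : ℝ) 16, 0 < V4 x) ∧
    (∀ W : ℝ → ℝ, SolvesMomentProblem W →
      ∀ᵐ x ∂(volume.restrict (Set.Icc (0 : ℝ) 16)), W x = V4 x) :=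
  ⟨solvesMomentProblem_V4, fun _ hx => V4_pos hx, fun _ hW => solvesMomentProblem_V4.ae_eq hW⟩
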